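/- Let $F$ be a local field of characteristic zero (i.e. a non-discrete locally compact Hausdorff topological field of characteristic $0$), and let $n,k\ge 0$ be integers. Let $G=GL_{n+k}(F)$ with its usual topology induced from $F$, let $H=GL_n(F)\times GL_k(F)\subset G$ be the block-diagonal subgroup, let $\varepsilon=\begin{pmatrix} Id_n & 0\\ 0 & -Id_k\end{pmatrix}$, and put $\theta(g)=\varepsilon g\varepsilon$ (an involution of $G$ whose fixed-point subgroup is $H$) and $\sigma(g)=\theta(g^{-1})$. Then the symmetric pair $(GL_{n+k},GL_n\times GL_k,\theta)$ is good: for every closed orbit $O\subset G$ of $H\times H$ acting by left and right multiplication (that is, every double coset $O=HgH$ that is closed in $G$), one has $\sigma(O)=O$. -/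

import Mathlib

open Matrix

/-- (The group of rational points of) a symmetric pair: a group `G` together with an involution `θ`
of `G` and the subgroup `H = G^θ` of fixed points of `θ`. -/
structure SymmetricPair (G : Type*) [Group G] where
  /-- the subgroup -/
  H : Subgroup G
  /-- the involution -/
  θ : G ≃* G
  involutive : ∀ g : G, θ (θ g) = g
  mem_H_iff : ∀ g : G, g ∈ H ↔ θ g = g

/-- The anti-involution `σ(g) = θ(g⁻¹)` of a symmetric pair. -/
def SymmetricPair.σ {G : Type*} [Group G] (P : SymmetricPair G) (g : G) : G :=
  P.θ g⁻¹

/-- A symmetric pair is good if `σ(O) = O` for every closed orbit `O` of `H × H` acting on `G`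
by left and right multiplication, i.e. for every closed double coset `O = H g H`. -/
def SymmetricPair.IsGood {G : Type*} [Group G] [TopologicalSpace G] (P : SymmetricPair G) : Prop :=
  ∀ O : Set G, (∃ g : G, O = DoubleCoset.doubleCoset g (P.H : Set G) (P.H : Set G)) →
    IsClosed O → P.σ '' O = O

/-- The standard block-diagonal embedding `GL_n × GL_k → GL_{n+k}`, `(a, d) ↦ diag(a, d)`.
Here `GL_{n+k}` is realised on the index set `Fin n ⊕ Fin k` of size `n + k`. -/
def glBlock (R : Type*) [CommRing R] (n k : ℕ) :
    GL (Fin n) R × GL (Fin k) R →* GL (Fin n ⊕ Fin k) R where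
  toFun p :=
    { val := fromBlocks (p.1 : Matrix (Fin n) (Fin n) R) 0 0 (p.2 : Matrix (Fin k) (Fin k) R)
      inv := fromBlocks ((p.1⁻¹ : GL (Fin n) R) : Matrix (Fin n) (Fin n) R) 0 0
        ((p.2⁻¹ : GL (Fin k) R) : Matrix (Fin k) (Fin k) R)
      val_inv := by
        rw [fromBlocks_multiply, ← Units.val_mul, ← Units.val_mul]
        simp
      inv_val := by
        rw [fromBlocks_multiply, ← Units.val_mul, ← Units.val_mul]
        simp }
  map_one' := by
    apply Units.ext
    simp
  map_mul' p q := by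
    apply Units.ext
    simp [fromBlocks_multiply]

/-- The element `ε = diag(Id_n, -Id_k)` of `GL_{n+k}`. -/
def glEps (R : Type*) [CommRing R] (n k : ℕ) : GL (Fin n ⊕ Fin k) R where
  val := fromBlocks 1 0 0 (-1)
  inv := fromBlocks 1 0 0 (-1)
  val_inv := by simp [fromBlocks_multiply]
  inv_val := by simp [fromBlocks_multiply]

theorem glEps_mul_self (R : Type*) [CommRing R] (n k : ℕ) :
    glEps R n k * glEps R n k = 1 :=
  Units.ext (glEps R n k).val_inv

/-- The involution `θ_{n,k}(x) = ε x ε` of `GL_{n+k}`. -/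
def glTheta (R : Type*) [CommRing R] (n k : ℕ) :
    GL (Fin n ⊕ Fin k) R ≃* GL (Fin n ⊕ Fin k) R where
  toFun x := glEps R n k * x * glEps R n k
  invFun x := glEps R n k * x * glEps R n k
  left_inv x := by
    have h := glEps_mul_self R n k
    calc glEps R n k * (glEps R n k * x * glEps R n k) * glEps R n k
        = (glEps R n k * glEps R n k) * x * (glEps R n k * glEps R n k) := by group
      _ = x := by rw [h, one_mul, mul_one]
  right_inv x := by
    have h := glEps_mul_self R n k
    calc glEps R n k * (glEps R n k * x * glEps R n k) * glEps R n k
        = (glEps R n k * glEps R n k) * x * (glEps R n k * glEps R n k) := by group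
      _ = x := by rw [h, one_mul, mul_one]
  map_mul' x y := by
    have h := glEps_mul_self R n k
    calc glEps R n k * (x * y) * glEps R n k
        = glEps R n k * x * 1 * y * glEps R n k := by group
      _ = glEps R n k * x * glEps R n k * (glEps R n k * y * glEps R n k) := by
        rw [← h]; group

/-- Over any commutative ring in which `2` is invertible, `GL_n × GL_k` is the group of fixed
points of `θ_{n,k}`. -/
theorem mem_range_glBlock_iff (R : Type*) [CommRing R] (h2 : IsUnit (2 : R)) (n k : ℕ)
    (g : GL (Fin n ⊕ Fin k) R) : g ∈ (glBlock R n k).range ↔ glTheta R n k g = g := by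
  have key : ∀ y : R, -y = y → y = 0 := fun y hy =>
    h2.mul_right_eq_zero.mp (by rw [two_mul]; nth_rewrite 1 [← hy]; simp)
  have off : ∀ u : GL (Fin n ⊕ Fin k) R, glTheta R n k u = u →
      (u : Matrix (Fin n ⊕ Fin k) (Fin n ⊕ Fin k) R) =
        fromBlocks u.val.toBlocks₁₁ 0 0 u.val.toBlocks₂₂ := by
    intro u hu
    have h : (fromBlocks 1 0 0 (-1) : Matrix (Fin n ⊕ Fin k) (Fin n ⊕ Fin k) R) * u.val *
        fromBlocks 1 0 0 (-1) = u.val := congrArg Units.val hu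
    rw [← fromBlocks_toBlocks u.val, fromBlocks_multiply, fromBlocks_multiply,
      fromBlocks_inj] at h
    obtain ⟨-, h12, h21, -⟩ := h
    nth_rewrite 1 [← fromBlocks_toBlocks u.val]
    congr 1
    · ext i j
      exact key _ (by simpa using congrFun (congrFun h12 i) j)
    · ext i j
      exact key _ (by simpa using congrFun (congrFun h21 i) j)
  constructor
  · rintro ⟨p, rfl⟩
    apply Units.ext
    change (fromBlocks 1 0 0 (-1) : Matrix (Fin n ⊕ Fin k) (Fin n ⊕ Fin k) R) *
      fromBlocks p.1.val 0 0 p.2.val * fromBlocks 1 0 0 (-1) = fromBlocks p.1.val 0 0 p.2.val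
    simp [fromBlocks_multiply]
  · intro hg
    have hg' : glTheta R n k g⁻¹ = g⁻¹ := by rw [map_inv, hg]
    have e := off g hg
    have e' := off g⁻¹ hg'
    have m := g.mul_inv
    have m' := g.inv_mul
    rw [e, e', fromBlocks_multiply, ← fromBlocks_one, fromBlocks_inj] at m m'
    refine ⟨(⟨g.val.toBlocks₁₁, (g⁻¹).val.toBlocks₁₁, by simpa using m.1, by simpa using m'.1⟩,
      ⟨g.val.toBlocks₂₂, (g⁻¹).val.toBlocks₂₂, by simpa using m.2.2.2,
        by simpa using m'.2.2.2⟩), Units.ext ?_⟩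
    exact e.symm

/-- The symmetric pair `(GL_{n+k}, GL_n × GL_k, θ_{n,k})` over a ring `R` in which `2` is
invertible; as `R` ranges over the algebras of a field, this is the pair of algebraic groups. -/
def glPair (R : Type*) [CommRing R] (h2 : IsUnit (2 : R)) (n k : ℕ) :
    SymmetricPair (GL (Fin n ⊕ Fin k) R) where
  H := (glBlock R n k).range
  θ := glTheta R n k
  involutive := (glTheta R n k).left_inv
  mem_H_iff := mem_range_glBlock_iff R h2 n k

/-! Put `e = ε` and `e' = g e g⁻¹`. Since `H` is the centralizer of `e`, the double coset of `g` is
determined by the pair `(e, e')` up to conjugation, and inverting `g` swaps the pair. As `σ` is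
inversion followed by conjugation by `ε ∈ H`, it suffices to find an invertible `c` interchanging
`e` and `e'`.

The sum `e + e'` intertwines the two involutions both ways, so only its kernel `K`, where `e' = -e`,
obstructs. If `K` has a complement stable under both, then `e + e'` is invertible there, so the
traces of `e` and `e'` agree on the complement, hence also on `K`. Thus `e` has trace zero on `K`,
and some involution of `K` anticommutes with it (`exists_isUnit_swap`).

Closedness provides the complement. Averaging gives an `e`-stable one, for which `e'` is block
triangular; dilations of `K` lie in `H` and contract `e'` to its block diagonal part, and the limit
stays in the double coset (`exists_mem_doubleCoset_of_isClosed`). -/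

/-! ### Linear algebra of two involutions -/

section InvolutionPairs

variable {F V : Type*} [Field F] [AddCommGroup V] [Module F V]

/-- Maschke's theorem for a pair of involutions acting on the kernel of their sum, on which both
act through the same one up to sign: the kernel has a complement stable under `e`. -/
theorem exists_projection_ker_add [NeZero (2 : F)] {e e' : Module.End F V} (he : e * e = 1)
    (he' : e' * e' = 1) :
    ∃ p : Module.End F V, p * p = p ∧ e * p = p * e ∧ (e + e') * p = 0 ∧
      ∀ v, (e + e') v = 0 → p v = v := by
  have h2 : (2 : F) ≠ 0 := NeZero.ne 2
  obtain ⟨q, hq⟩ := (LinearMap.ker (e + e')).exists_isCompl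
  set r : Module.End F V := (LinearMap.ker (e + e')).subtype ∘ₗ
    (LinearMap.ker (e + e')).projectionOnto q hq with hr
  have hrmem (v : V) : (e + e') (r v) = 0 := (((LinearMap.ker (e + e')).projectionOnto q hq) v).2
  have hrid (v : V) (hv : (e + e') v = 0) : r v = v :=
    congrArg Subtype.val (Submodule.projectionOnto_apply_left hq ⟨v, hv⟩)
  -- Both sides equal `1 + e' * e`; hence the kernel is stable under `e`, and averaging `r` over
  -- `{1, e}` still gives a projection onto it.
  have hM : (e + e') * e = e' * (e + e') := by
    linear_combination (norm := noncomm_ring) he - he'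
  have hMe (v : V) (hv : (e + e') v = 0) : (e + e') (e v) = 0 := by
    have := LinearMap.congr_fun hM v
    simpa only [Module.End.mul_apply, hv, map_zero] using this
  have hp (v : V) (hv : (e + e') v = 0) : ((2⁻¹ : F) • (r + e * r * e)) v = v := by
    have hee : e (e v) = v := LinearMap.congr_fun he v
    simp only [LinearMap.smul_apply, LinearMap.add_apply, Module.End.mul_apply, hrid v hv,
      hrid _ (hMe v hv), hee]
    rw [← two_smul F v, inv_smul_smul₀ h2]
  have hMp (v : V) : (e + e') (((2⁻¹ : F) • (r + e * r * e)) v) = 0 := by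
    simp only [LinearMap.smul_apply, LinearMap.add_apply r,
      Module.End.mul_apply, map_smul, map_add, hrmem, hMe _ (hrmem _), add_zero, smul_zero]
  refine ⟨(2⁻¹ : F) • (r + e * r * e), LinearMap.ext fun v ↦ hp _ (hMp v), ?_,
    LinearMap.ext hMp, hp⟩
  rw [mul_smul_comm, smul_mul_assoc]
  congr 1
  linear_combination (norm := noncomm_ring) he * r * e - e * r * he

/-- Idempotents of equal trace have isomorphic ranges, in the form of a factorization. -/
theorem IsIdempotentElem.exists_factorization_of_trace_eq [CharZero F] [FiniteDimensional F V]
    {P Q : Module.End F V} (hP : IsIdempotentElem P) (hQ : IsIdempotentElem Q)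
    (ht : LinearMap.trace F V P = LinearMap.trace F V Q) :
    ∃ u w : Module.End F V, u * w = Q ∧ w * u = P ∧ Q * u = u ∧ u * P = u ∧ P * w = w ∧
      w * Q = w := by
  have iP := LinearMap.IsIdempotentElem.isProj_range P hP
  have iQ := LinearMap.IsIdempotentElem.isProj_range Q hQ
  -- The trace of an idempotent is its rank, which characteristic zero recovers.
  rw [iP.trace, iQ.trace, Nat.cast_inj] at ht
  let a := LinearEquiv.ofFinrankEq _ _ ht
  have hu (x : LinearMap.range P) : iP.codRestrict (x : V) = x := iP.codRestrict_apply_cod x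
  have hw (x : LinearMap.range Q) : iQ.codRestrict (x : V) = x := iQ.codRestrict_apply_cod x
  refine ⟨(LinearMap.range Q).subtype ∘ₗ a.toLinearMap ∘ₗ iP.codRestrict,
    (LinearMap.range P).subtype ∘ₗ a.symm.toLinearMap ∘ₗ iQ.codRestrict,
    ?_, ?_, ?_, ?_, ?_, ?_⟩ <;> ext v <;>
    simp only [Module.End.mul_apply, LinearMap.comp_apply, Submodule.subtype_apply,
      LinearEquiv.coe_coe, hu, hw, LinearEquiv.apply_symm_apply, LinearEquiv.symm_apply_apply]
  · rfl
  · rfl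
  · exact iQ.map_id _ (Subtype.mem _)
  · exact congrArg (fun x ↦ (a x : V)) (hu (iP.codRestrict v))
  · exact iP.map_id _ (Subtype.mem _)
  · exact congrArg (fun x ↦ (a.symm x : V)) (hw (iQ.codRestrict v))

/-- An involution `e` of trace zero on the range of a commuting idempotent `p` is conjugate there
to `-e`, by an involution `s` of the range. -/
theorem exists_involution_anticommute [CharZero F] [FiniteDimensional F V] {e p : Module.End F V}
    (he : e * e = 1) (hp : p * p = p) (hep : e * p = p * e)
    (ht : LinearMap.trace F V (e * p) = 0) :
    ∃ s : Module.End F V, s * s = p ∧ p * s = s ∧ s * p = s ∧ s * e = -(e * s) := by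
  have h2 : (2 : F) ≠ 0 := two_ne_zero
  have idem (f : Module.End F V) (hf : f * f = 1) (hfp : f * p = p * f) :
      IsIdempotentElem ((2⁻¹ : F) • (p + f * p)) := by
    have : (p + f * p) * (p + f * p) = (2 : F) • (p + f * p) := by
      rw [two_smul]
      linear_combination (norm := noncomm_ring) hp - hfp * p + 2 * f * hp - f * hfp * p
        + f * f * hp + hf * p
    rw [IsIdempotentElem, smul_mul_smul_comm, this, smul_smul, mul_assoc, inv_mul_cancel₀ h2,
      mul_one]
  -- `P` and `Q` project onto the `±1` eigenspaces of `e` in the range of `p`. Trace zero makes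
  -- their ranks equal, and `u + w` exchanges them.
  set P := (2⁻¹ : F) • (p + e * p) with hPdef
  set Q := (2⁻¹ : F) • (p + (-e) * p) with hQdef
  have hP : IsIdempotentElem P := idem e he hep
  have hQ : IsIdempotentElem Q := idem (-e) (by rw [neg_mul_neg, he]) (by
    rw [neg_mul, mul_neg, hep])
  have hPQ : P + Q = p := by
    rw [hPdef, hQdef, ← smul_add, neg_mul, add_add_add_comm, add_neg_cancel, add_zero,
      ← two_smul F p, inv_smul_smul₀ h2]
  have hPQ' : P - Q = e * p := by
    rw [hPdef, hQdef, ← smul_sub, neg_mul, add_sub_add_left_eq_sub, sub_neg_eq_add,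
      ← two_smul F (e * p), inv_smul_smul₀ h2]
  have hPQ0 : P * Q = 0 := by
    have : P * Q + P * P = P * p := by rw [← mul_add, add_comm Q, hPQ]
    have hPp : P * p = P := by
      rw [hPdef, smul_mul_assoc, add_mul, mul_assoc, hp]
    rw [hP.eq, hPp] at this
    simpa using this
  have hQP0 : Q * P = 0 := by
    have : Q * P + Q * Q = Q * p := by rw [← mul_add, hPQ]
    have hQp : Q * p = Q := by
      rw [hQdef, smul_mul_assoc, add_mul, mul_assoc, hp]
    rw [hQ.eq, hQp] at this
    simpa using this
  obtain ⟨u, w, huw, hwu, hQu, huP, hPw, hwQ⟩ := hP.exists_factorization_of_trace_eq hQ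
    (sub_eq_zero.1 (by rw [← map_sub, hPQ', ht]))
  have huQ : u * Q = 0 := by rw [← huP, mul_assoc, hPQ0, mul_zero]
  have hwP : w * P = 0 := by rw [← hwQ, mul_assoc, hQP0, mul_zero]
  have hPu : P * u = 0 := by rw [← hQu, ← mul_assoc, hPQ0, zero_mul]
  have hQw : Q * w = 0 := by rw [← hPw, ← mul_assoc, hQP0, zero_mul]
  have huu : u * u = 0 := by
    rw [← hQu, mul_assoc, ← mul_assoc u, huQ, zero_mul, mul_zero]
  have hww : w * w = 0 := by
    rw [← hPw, mul_assoc, ← mul_assoc w, hwP, zero_mul, mul_zero]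
  have hps : p * (u + w) = u + w := by
    rw [← hPQ, add_mul, mul_add, mul_add, hPu, hPw, hQu, hQw, zero_add, add_zero, add_comm]
  have hsp : (u + w) * p = u + w := by
    rw [← hPQ, mul_add, add_mul, add_mul, huP, hwP, huQ, hwQ, zero_add, add_zero]
  refine ⟨u + w, ?_, hps, hsp, ?_⟩
  · rw [mul_add, add_mul, add_mul, huu, huw, hwu, hww, zero_add, add_zero, hPQ]
  · calc (u + w) * e = (u + w) * (P - Q) := by rw [hPQ', hep, ← mul_assoc, hsp]
      _ = -((P - Q) * (u + w)) := by
        rw [mul_sub, sub_mul, add_mul, add_mul, mul_add, mul_add, huP, hwP, huQ, hwQ, hPu, hPw,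
          hQu, hQw]
        abel
      _ = -(e * (u + w)) := by rw [hPQ', mul_assoc, hps]

/-- Two involutions of equal trace which commute with the projection `p` onto the kernel of
their sum are simultaneously conjugate to each other. -/
theorem exists_isUnit_swap [CharZero F] [FiniteDimensional F V] {e e' p : Module.End F V}
    (he : e * e = 1) (he' : e' * e' = 1) (hp : p * p = p) (hep : e * p = p * e)
    (hep' : e' * p = p * e') (hKp : (e + e') * p = 0) (hpK : ∀ v, (e + e') v = 0 → p v = v)
    (ht : LinearMap.trace F V e = LinearMap.trace F V e') :
    ∃ c : Module.End F V, IsUnit c ∧ c * e = e' * c ∧ c * e' = e * c := by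
  have hpK' : p * (e + e') = 0 := by rw [mul_add, ← hep, ← hep', ← add_mul, hKp]
  -- a perturbation of `e + e'` by an invertible map of the range of `p` is invertible
  have unit (s r : Module.End F V) (hps : p * s = s) (hrs : r * s = p) :
      IsUnit (e + e' + s) := by
    rw [LinearMap.isUnit_iff_ker_eq_bot, LinearMap.ker_eq_bot']
    intro v hv
    have h1 : s v = 0 := by
      have h : p * (e + e' + s) = s := by rw [mul_add, hpK', zero_add, hps]
      rw [← h, Module.End.mul_apply, hv, map_zero]
    have h3 : (e + e') v = 0 := by rwa [LinearMap.add_apply, h1, add_zero] at hv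
    rw [← hpK v h3, ← hrs, Module.End.mul_apply, h1, map_zero]
  have ht0 : LinearMap.trace F V (e * p) = 0 := by
    -- The unit `e + e' + p` conjugates `e` to `e'` off the range of `p`, while `e' = -e` on it.
    obtain ⟨c, hc⟩ := unit p p hp hp
    have hcc : e * (1 - p) = ↑c * (e' * (1 - p)) * ↑c⁻¹ := by
      rw [Units.eq_mul_inv_iff_mul_eq, hc]
      linear_combination (norm := noncomm_ring) he - he' - e * hp - e * hpK' + hep' + e' * hp
        - hep' * p + e * hKp + he' * p - he * p
    have h1 : LinearMap.trace F V (e * (1 - p)) = LinearMap.trace F V (e' * (1 - p)) := by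
      rw [hcc, LinearMap.trace_conj]
    have h2 : LinearMap.trace F V (e' * p) = - LinearMap.trace F V (e * p) := by
      rw [← map_neg]
      congr 1
      linear_combination (norm := noncomm_ring) hKp
    rw [mul_sub, mul_sub, map_sub, map_sub, mul_one, mul_one, ht, h2] at h1
    have : (2 : F) * LinearMap.trace F V (e * p) = 0 := by linear_combination - h1
    exact (mul_eq_zero.1 this).resolve_left two_ne_zero
  obtain ⟨s, hss, hps, hsp, hse⟩ := exists_involution_anticommute he hp hep ht0
  refine ⟨e + e' + s, unit s s hps hss, ?_, ?_⟩
  · linear_combination (norm := noncomm_ring) he - he' + hse + (e + e') * hps - hKp * s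
  · linear_combination (norm := noncomm_ring) he' - he - hse + s * hpK' - hsp * (e + e')

end InvolutionPairs

/-! ### Contraction inside a closed double coset -/

/-- If an involution `e'` stabilizes the range of `p`, its block diagonal part `e''` with respect
to `p` is conjugate to `e'` by a unipotent block triangular element. -/
theorem exists_unipotent_conj_blockDiagonal {F A : Type*} [Field F] [NeZero (2 : F)] [Ring A]
    [Algebra F A] {e' p : A} (he' : e' * e' = 1) (hp : p * p = p) (h : p * e' * p = e' * p) :
    ∃ e'' m : A, e'' * p = p * e'' ∧ e'' * p = e' * p ∧ p * m = m ∧ m * p = 0 ∧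
      e' * (1 + m) = (1 + m) * e'' := by
  have h2 : (2 : F) ≠ 0 := NeZero.ne 2
  set n : A := p * e' * (1 - p) with hn
  have hpn : p * n = n := by
    rw [hn]
    linear_combination (norm := noncomm_ring) hp * e' * (1 - p)
  have hnp : n * p = 0 := by
    rw [hn]
    linear_combination (norm := noncomm_ring) -p * e' * hp
  have hnn : n * n = 0 := by rw [← hpn, ← mul_assoc, mul_assoc p, hnp, mul_zero, zero_mul]
  have hnep : n * e' * p = 0 := by
    linear_combination (norm := noncomm_ring) hnp * e' * p - n * h
  have hanti : e' * n = -(n * e') := by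
    rw [hn]
    linear_combination (norm := noncomm_ring) p * he' - he' * p - h * e' - e' * h
  -- Here `1 + m` is `(1 + e' * e'') / 2`, the usual intertwiner of two involutions.
  refine ⟨e' - n, (2⁻¹ : F) • (n * e'), ?_, ?_, ?_, ?_, ?_⟩
  · rw [hn]
    linear_combination (norm := noncomm_ring) p * e' * hp - h + hp * e' * (1 - p)
  · rw [sub_mul, hnp, sub_zero]
  · rw [mul_smul_comm, ← mul_assoc, hpn]
  · rw [smul_mul_assoc, hnep, smul_zero]
  · have h3 : e' * (n * e') = -n := by
      linear_combination (norm := noncomm_ring) hanti * e' - n * he'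
    have h4 : n * e' * (e' - n) = n := by
      linear_combination (norm := noncomm_ring) n * he' - n * hanti + hnn * e'
    rw [mul_add, add_mul, mul_smul_comm, smul_mul_assoc, h3, h4, mul_one, one_mul, smul_neg]
    nth_rewrite 2 [← inv_smul_smul₀ h2 n]
    rw [two_smul, smul_add]
    abel

/-- Conjugate endomorphisms with nested kernels have the same kernel. -/
theorem LinearMap.ker_eq_of_le_of_conj {F V : Type*} [Field F] [AddCommGroup V] [Module F V]
    [FiniteDimensional F V] {M M' : Module.End F V} (x : (Module.End F V)ˣ)
    (h : M' * x = x * M) (hle : LinearMap.ker M ≤ LinearMap.ker M') :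
    LinearMap.ker M = LinearMap.ker M' := by
  refine Submodule.eq_of_le_of_finrank_le hle ?_
  refine (Submodule.finrank_mono (t := (LinearMap.ker M).map x.val) fun v hv ↦ ?_).trans
    (Submodule.finrank_map_le _ _)
  refine ⟨x⁻¹.val v, ?_, LinearMap.congr_fun x.mul_inv v⟩
  have h' : M * x⁻¹.val = x⁻¹.val * M' := by
    rw [Units.eq_inv_mul_iff_mul_eq, ← mul_assoc, ← h, mul_assoc, x.mul_inv, mul_one]
  have := LinearMap.congr_fun h' v
  rw [Module.End.mul_apply, Module.End.mul_apply, LinearMap.mem_ker.1 hv, map_zero] at this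
  exact this

/-- The one-parameter group `t ↦ 1 + t m` attached to an element `m` of square zero. -/
def unipotentUnit {F A : Type*} [CommRing F] [Ring A] [Algebra F A] {m : A} (hm : m * m = 0)
    (t : F) : Aˣ where
  val := 1 + t • m
  inv := 1 - t • m
  val_inv := by
    have : (t • m) * (t • m) = 0 := by rw [smul_mul_smul_comm, hm, smul_zero]
    rw [add_mul, one_mul, mul_sub, this, mul_one, sub_zero, sub_add_cancel]
  inv_val := by
    have : (t • m) * (t • m) = 0 := by rw [smul_mul_smul_comm, hm, smul_zero]
    rw [sub_mul, one_mul, mul_add, this, mul_one, add_zero, add_sub_cancel_right]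

theorem continuous_unipotentUnit {F A : Type*} [CommRing F] [TopologicalSpace F] [Ring A]
    [Algebra F A] [TopologicalSpace A] [IsTopologicalRing A] [ContinuousSMul F A] {m : A}
    (hm : m * m = 0) : Continuous (unipotentUnit (F := F) hm) := by
  refine Units.continuous_iff.2 ⟨?_, ?_⟩
  · exact continuous_const.add (continuous_id.smul continuous_const)
  · exact continuous_const.sub (continuous_id.smul continuous_const)

/-- The one-parameter subgroup acting by `t` on the range of an idempotent `p` and trivially on
its kernel. -/
def dilationUnit {F A : Type*} [Field F] [Ring A] [Algebra F A] {p : A} (hp : p * p = p)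
    {t : F} (ht : t ≠ 0) : Aˣ where
  val := 1 - p + t • p
  inv := 1 - p + t⁻¹ • p
  val_inv := by
    have h : (t • p) * (t⁻¹ • p) = p := by
      rw [smul_mul_smul_comm, hp, mul_inv_cancel₀ ht, one_smul]
    have h1 : p * (t⁻¹ • p) = t⁻¹ • p := by rw [mul_smul_comm, hp]
    have h2 : (t • p) * p = t • p := by rw [smul_mul_assoc, hp]
    generalize t • p = x, t⁻¹ • p = y at *
    linear_combination (norm := noncomm_ring) h - h1 - h2 + hp
  inv_val := by
    have h : (t⁻¹ • p) * (t • p) = p := by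
      rw [smul_mul_smul_comm, hp, inv_mul_cancel₀ ht, one_smul]
    have h1 : p * (t • p) = t • p := by rw [mul_smul_comm, hp]
    have h2 : (t⁻¹ • p) * p = t⁻¹ • p := by rw [smul_mul_assoc, hp]
    generalize t • p = x, t⁻¹ • p = y at *
    linear_combination (norm := noncomm_ring) h - h1 - h2 + hp

theorem commute_dilationUnit {F A : Type*} [Field F] [Ring A] [Algebra F A] {p : A}
    (hp : p * p = p) {t : F} (ht : t ≠ 0) {e : Aˣ} (h : e * p = p * e) :
    dilationUnit hp ht * e = e * dilationUnit hp ht := by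
  refine Units.ext ?_
  change (1 - p + t • p) * (e : A) = e * (1 - p + t • p)
  rw [add_mul, mul_add, sub_mul, mul_sub, smul_mul_assoc, mul_smul_comm, h, one_mul, mul_one]

/-- Since `m` maps into the range of `p` and kills it, dilation by `t` rescales `m` to `t • m`; as
`t → 0` this contracts `1 + m` to `1`. -/
theorem dilationUnit_mul_unipotentUnit {F A : Type*} [Field F] [Ring A] [Algebra F A] {p m : A}
    (hp : p * p = p) (hpm : p * m = m) (hmp : m * p = 0) (hm : m * m = 0) {t : F} (ht : t ≠ 0) :
    dilationUnit hp ht * unipotentUnit hm (1 : F) = unipotentUnit hm t * dilationUnit hp ht := by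
  refine Units.ext ?_
  change (1 - p + t • p) * (1 + (1 : F) • m) = (1 + t • m) * (1 - p + t • p)
  have h1 : (t • p) * m = t • m := by rw [smul_mul_assoc, hpm]
  have h2 : (t • m) * p = 0 := by rw [smul_mul_assoc, hmp, smul_zero]
  have h3 : (t • m) * (t • p) = 0 := by rw [smul_mul_smul_comm, hmp, smul_zero]
  rw [one_smul]
  generalize t • p = x, t • m = y at *
  linear_combination (norm := noncomm_ring) h1 - hpm + h2 - h3

/-- Let `e` be an involution and `H` its centralizer. If the double coset `H g H` is closed, it
contains `g₀` such that the projection to the kernel of `e + g₀ e g₀⁻¹` along a suitable complement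
commutes with both `e` and `g₀ e g₀⁻¹`. -/
theorem exists_mem_doubleCoset_of_isClosed {F A : Type*} [Field F] [NeZero (2 : F)]
    [TopologicalSpace F] [T1Space F] [ContinuousAdd F] (hF : ¬ DiscreteTopology F)
    [Ring A] [Algebra F A] [TopologicalSpace A] [IsTopologicalRing A] [ContinuousSMul F A] {e g : Aˣ} (he : e * e = 1)
    {H : Subgroup Aˣ} (hH : ∀ x, x ∈ H ↔ x * e = e * x)
    (hcl : IsClosed (DoubleCoset.doubleCoset g (H : Set Aˣ) H)) {p : A} (hp : p * p = p)
    (hep : e * p = p * e) (hKp : ((e : A) + (g * e * g⁻¹ : Aˣ)) * p = 0) :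
    ∃ g₀ ∈ DoubleCoset.doubleCoset g (H : Set Aˣ) H,
      (g₀ * e * g₀⁻¹ : Aˣ) * p = p * (g₀ * e * g₀⁻¹ : Aˣ) ∧
      ((e : A) + (g₀ * e * g₀⁻¹ : Aˣ)) * p = 0 := by
  have he' : ((g * e * g⁻¹ : Aˣ) : A) * (g * e * g⁻¹ : Aˣ) = 1 := by
    rw [← Units.val_mul, ← Units.val_one]
    congr 1
    rw [show g * e * g⁻¹ * (g * e * g⁻¹) = g * (e * e) * g⁻¹ by group, he]
    group
  obtain ⟨e'', m, hep'', hpe'', hpm, hmp, hconj⟩ :=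
    exists_unipotent_conj_blockDiagonal (F := F) he' hp (by
      linear_combination (norm := noncomm_ring) p * hKp - hKp + hep * p - e * hp)
  have hm : m * m = 0 := by rw [← hpm, ← mul_assoc, mul_assoc p, hmp, mul_zero, zero_mul]
  set c : F → Aˣ := unipotentUnit hm with hc
  set g₀ : Aˣ := (c 1)⁻¹ * g with hg₀
  have hge : ((g₀ * e * g₀⁻¹ : Aˣ) : A) = e'' := by
    have h1 : ((g * e * g⁻¹ : Aˣ) : A) * c 1 = c 1 * e'' := by
      rw [show ((c 1 : Aˣ) : A) = 1 + (1 : F) • m from rfl, one_smul, hconj]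
    rw [show g₀ * e * g₀⁻¹ = (c 1)⁻¹ * ((g * e * g⁻¹) * c 1) by rw [hg₀]; group, Units.val_mul,
      Units.val_mul _ (c 1), h1, Units.inv_mul_cancel_left]
  -- With `d` the dilation, `c t * g₀ = d * g * (g₀⁻¹ * d⁻¹ * g₀)`. The last factor is in `H`
  -- because `d` commutes with `g₀ e g₀⁻¹`.
  have hmem (t : F) (ht : t ≠ 0) : c t * g₀ ∈ DoubleCoset.doubleCoset g (H : Set Aˣ) H := by
    refine DoubleCoset.mem_doubleCoset.2 ⟨dilationUnit hp ht,
      (hH _).2 (commute_dilationUnit hp ht hep), g₀⁻¹ * (dilationUnit hp ht)⁻¹ * g₀, ?_, ?_⟩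
    · have h1 := commute_dilationUnit hp ht (e := g₀ * e * g₀⁻¹) (by rw [hge, hep''])
      have h2 : Commute (dilationUnit hp ht)⁻¹ (g₀ * e * g₀⁻¹) := Commute.inv_left h1
      refine (hH _).2 ?_
      calc g₀⁻¹ * (dilationUnit hp ht)⁻¹ * g₀ * e
          = g₀⁻¹ * ((dilationUnit hp ht)⁻¹ * (g₀ * e * g₀⁻¹)) * g₀ := by group
        _ = e * (g₀⁻¹ * (dilationUnit hp ht)⁻¹ * g₀) := by rw [h2.eq]; group
    · rw [show c t = _ from
          eq_mul_inv_of_mul_eq (dilationUnit_mul_unipotentUnit hp hpm hmp hm ht).symm,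
        show g = unipotentUnit hm (1 : F) * g₀ by rw [hg₀, hc]; group]
      group
  refine ⟨g₀, ?_, ?_, ?_⟩
  · have hne : (nhdsWithin (0 : F) {0}ᶜ).NeBot := by
      rw [Filter.neBot_iff, Ne, ← isOpen_singleton_iff_punctured_nhds]
      exact fun h ↦ hF (discreteTopology_of_isOpen_singleton_zero h)
    have hc0 : c 0 = 1 := Units.ext (by simp [hc, unipotentUnit])
    have hcont : Continuous fun t ↦ c t * g₀ :=
      (continuous_unipotentUnit (F := F) hm).mul continuous_const
    have hlim := (hcont.tendsto 0).mono_left (nhdsWithin_le_nhds (s := {0}ᶜ))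
    rw [hc0, one_mul] at hlim
    exact hcl.mem_of_tendsto hlim (Filter.eventually_of_mem self_mem_nhdsWithin hmem)
  · rw [hge, hep'']
  · rw [hge, add_mul, hpe'', ← add_mul, hKp]

/-! ### Inversion of closed double cosets -/

/-- If `e` is an involution of `GL`, with centralizer `H`, then every closed double coset `H g H`
is stable under inversion. -/
theorem inv_mem_doubleCoset_of_isClosed {F ι : Type*} [Field F] [CharZero F]
    [TopologicalSpace F] [IsTopologicalRing F] [T1Space F] (hF : ¬ DiscreteTopology F) [Fintype ι]
    [DecidableEq ι] {e g : GL ι F} (he : e * e = 1) {H : Subgroup (GL ι F)}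
    (hH : ∀ x, x ∈ H ↔ x * e = e * x)
    (hcl : IsClosed (DoubleCoset.doubleCoset g (H : Set (GL ι F)) H)) :
    g⁻¹ ∈ DoubleCoset.doubleCoset g (H : Set (GL ι F)) H := by
  let φ : Matrix ι ι F ≃ₐ[F] Module.End F (ι → F) := Matrix.toLinAlgEquiv'
  let ψ : GL ι F ≃* (Module.End F (ι → F))ˣ := Units.mapEquiv φ.toMulEquiv
  have hsq (x : GL ι F) : (ψ (x * e * x⁻¹)).val * (ψ (x * e * x⁻¹)).val = 1 := by
    rw [← Units.val_mul, ← map_mul,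
      show x * e * x⁻¹ * (x * e * x⁻¹) = x * (e * e) * x⁻¹ by group, he, mul_one, mul_inv_cancel,
      map_one, Units.val_one]
  have hsqe : (ψ e).val * (ψ e).val = 1 := by
    rw [← Units.val_mul, ← map_mul, he, map_one, Units.val_one]
  obtain ⟨p', hp, hep, hKp, hpK⟩ := exists_projection_ker_add hsqe (hsq g)
  obtain ⟨p, rfl⟩ := φ.surjective p'
  obtain ⟨g₀, hg₀, hcomm, hK₀⟩ := exists_mem_doubleCoset_of_isClosed hF he hH hcl (p := p)
    (φ.injective (by rw [map_mul, hp]))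
    (φ.injective (by rw [map_mul, map_mul]; exact hep))
    (φ.injective (by rw [map_mul, map_add, map_zero]; exact hKp))
  obtain ⟨x, hx, y, hy, hxy⟩ := DoubleCoset.mem_doubleCoset.1 hg₀
  have hxe := (hH x).1 hx
  have hye := (hH y).1 hy
  have hconj : g₀ * e * g₀⁻¹ = x * (g * e * g⁻¹) * x⁻¹ := by
    calc g₀ * e * g₀⁻¹ = x * (g * (y * e) * y⁻¹ * g⁻¹) * x⁻¹ := by rw [hxy]; group
      _ = x * (g * e * g⁻¹) * x⁻¹ := by rw [hye]; group
  replace hcomm := congrArg φ hcomm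
  rw [map_mul, map_mul] at hcomm
  replace hK₀ := congrArg φ hK₀
  rw [map_mul, map_add, map_zero] at hK₀
  change (ψ (g₀ * e * g₀⁻¹)).val * φ p = φ p * (ψ (g₀ * e * g₀⁻¹)).val at hcomm
  change ((ψ e).val + (ψ (g₀ * e * g₀⁻¹)).val) * φ p = 0 at hK₀
  -- The kernel cannot grow in the limit: `x ∈ H` conjugates one sum to the other.
  have hker : LinearMap.ker ((ψ e).val + (ψ (g * e * g⁻¹)).val) =
      LinearMap.ker ((ψ e).val + (ψ (g₀ * e * g₀⁻¹)).val) := by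
    refine LinearMap.ker_eq_of_le_of_conj (ψ x) ?_ fun v hv ↦ ?_
    · rw [add_mul, mul_add, ← Units.val_mul, ← Units.val_mul, ← Units.val_mul, ← Units.val_mul,
        ← map_mul, ← map_mul, ← map_mul, ← map_mul, hxe, hconj, inv_mul_cancel_right]
    · rw [LinearMap.mem_ker, ← hpK v hv]
      exact LinearMap.congr_fun hK₀ v
  have htr : LinearMap.trace F (ι → F) (ψ e).val =
      LinearMap.trace F (ι → F) (ψ (g₀ * e * g₀⁻¹)).val := by
    rw [map_mul, map_mul, map_inv, Units.val_mul, Units.val_mul, LinearMap.trace_conj]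
  obtain ⟨c', ⟨c'', rfl⟩, hc₁, hc₂⟩ := exists_isUnit_swap hsqe (hsq g₀) hp hep hcomm hK₀
    (fun v hv ↦ hpK v (hker.ge hv)) htr
  obtain ⟨c, rfl⟩ := ψ.surjective c''
  rw [← Units.val_mul, ← Units.val_mul, Units.val_inj, ← map_mul, ← map_mul, ψ.injective.eq_iff]
    at hc₁ hc₂
  have hk : c⁻¹ * g₀ ∈ H := (hH _).2 <| by
    calc c⁻¹ * g₀ * e = c⁻¹ * (g₀ * e * g₀⁻¹ * c) * c⁻¹ * g₀ := by group
      _ = e * (c⁻¹ * g₀) := by rw [← hc₁]; group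
  have hl : c * g₀ ∈ H := (hH _).2 <| by
    calc c * g₀ * e = c * (g₀ * e * g₀⁻¹) * g₀ := by group
      _ = e * (c * g₀) := by rw [hc₂]; group
  -- From `g₀⁻¹ = (c * g₀)⁻¹ * g₀ * (c⁻¹ * g₀)⁻¹` and `g₀ = x * g * y`.
  refine DoubleCoset.mem_doubleCoset.2 ⟨y * (c * g₀)⁻¹ * x,
    H.mul_mem (H.mul_mem hy (H.inv_mem hl)) hx, y * (c⁻¹ * g₀)⁻¹ * x,
    H.mul_mem (H.mul_mem hy (H.inv_mem hk)) hx, ?_⟩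
  calc g⁻¹ = y * (x * g * y)⁻¹ * x := by group
    _ = y * (c * g₀)⁻¹ * (x * g * y) * (c⁻¹ * g₀)⁻¹ * x := by rw [← hxy]; group
    _ = y * (c * g₀)⁻¹ * x * g * (y * (c⁻¹ * g₀)⁻¹ * x) := by group

theorem mainTheorem4 (F : Type*) [Field F] [CharZero F] [TopologicalSpace F]
    [IsTopologicalDivisionRing F] [T2Space F] [LocallyCompactSpace F]
    (hF : ¬ DiscreteTopology F) (n k : ℕ) :
    (glPair F (IsUnit.mk0 2 two_ne_zero) n k).IsGood := by
  set P := glPair F (IsUnit.mk0 2 two_ne_zero) n k with hP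
  have hee := glEps_mul_self F n k
  have hinv : (glEps F n k)⁻¹ = glEps F n k := inv_eq_of_mul_eq_one_left hee
  have hH (x : GL (Fin n ⊕ Fin k) F) : x ∈ P.H ↔ x * glEps F n k = glEps F n k * x := by
    rw [P.mem_H_iff]
    change glEps F n k * x * glEps F n k = x ↔ _
    rw [← eq_mul_inv_iff_mul_eq, hinv, eq_comm]
  have heH : glEps F n k ∈ P.H := (hH _).2 rfl
  rintro O ⟨g, rfl⟩ hcl
  obtain ⟨x, hx, y, hy, hxy⟩ := DoubleCoset.mem_doubleCoset.1
    (inv_mem_doubleCoset_of_isClosed hF hee hH hcl)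
  have hσ (z : GL (Fin n ⊕ Fin k) F) (hz : z ∈ DoubleCoset.doubleCoset g (P.H : Set _) P.H) :
      P.σ z ∈ DoubleCoset.doubleCoset g (P.H : Set _) P.H := by
    obtain ⟨a, ha, b, hb, rfl⟩ := DoubleCoset.mem_doubleCoset.1 hz
    refine DoubleCoset.mem_doubleCoset.2 ⟨glEps F n k * b⁻¹ * x,
      P.H.mul_mem (P.H.mul_mem heH (P.H.inv_mem hb)) hx, y * a⁻¹ * glEps F n k,
      P.H.mul_mem (P.H.mul_mem hy (P.H.inv_mem ha)) heH, ?_⟩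
    change glEps F n k * (a * g * b)⁻¹ * glEps F n k = _
    rw [show (a * g * b)⁻¹ = b⁻¹ * g⁻¹ * a⁻¹ by group, hxy]
    group
  -- One inclusion suffices because `σ` is an involution.
  refine (Set.image_subset_iff.2 hσ).antisymm fun z hz ↦ ⟨P.σ z, hσ z hz, ?_⟩
  change P.θ (P.θ z⁻¹)⁻¹ = z
  rw [← map_inv, inv_inv, P.involutive]
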